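/- **Model.** In each slot $t\in\{0,1,2,\dots\}$ a supplier has renewable supply $s(t)\in[0,s_{\max}]$, there is a demand state $y(t)$ (in some measurable space), and outside energy has the unit price $\gamma(t)\in[0,\gamma_{\max}]$. The supplier chooses an outside purchase $x(t)\in[0,x_{\max}]$, an acceptance decision $b(t)\in\{0,1\}$ and a price $p(t)\in[0,p_{\max}]$. Then requests $a(t)\in[0,a_{\max}]$ arrive, with $a(t)=0$ if $b(t)=0$. Given the history before slot $t$, the present state $(s(t),y(t),\gamma(t))$ and the present decisions, $a(t)$ has mean $b(t)F(p(t),y(t),\gamma(t))$, where the demand function $F$ is measurable, continuous in the price $p\in[0,p_{\max}]$, and takes values in $[0,a_{\max}]$. The profit of slot $t$ is $\phi(t)=b(t)p(t)a(t)-\gamma(t)x(t)$. The queue backlog, served first-in-first-out, and the virtual queue with parameter $\epsilon\ge0$ are given by $Q(0)=Z(0)=0$ and $$Q(t+1)=\max[Q(t)-s(t)-x(t),0]+a(t),\qquad Z(t+1)=\max[Z(t)-s(t)-x(t)+\epsilon 1_{\{Q(t)>0\}},0].$$ **Policy.** Let $V>0$. In each slot the joint pricing and allocation policy chooses $p(t)$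 as a maximizer of $F(p,y(t),\gamma(t))(Vp-Q(t))$ over $p\in[0,p_{\max}]$; it sets $b(t)=1$ if the maximum is nonnegative and $b(t)=0$ otherwise; and it sets $x(t)=0$ if $Q(t)+Z(t)\le V\gamma(t)$ and $x(t)=x_{\max}$ otherwise. **Optimality.** Let $(s(t),y(t),\gamma(t))$ be i.i.d. over slots, each state being independent of the history of the system before its slot. Let $\phi^*$ be the supremum of the limiting time-average profits $\lim_{t\to\infty}\frac1t\sum_{\tau=0}^{t-1}\mathbb E[\phi(\tau)]$ over all algorithms that satisfy the above constraints on $x,b,p$, for which this limit exists, and for which $\limsup_{t\to\infty}\frac1t\sum_{\tau=0}^{t-1}\mathbb E[Q(\tau)]<\infty$. An $(s,y,\gamma)$-only policy is a stationary randomized choice of $(x^*,b^*,p^*)$ within the same constraints that depends only on the present $(s,y,\gamma)$; let $a^*(t)$ denote the resulting requests. Let $a^*$ be the largest value (supremum) of $\mathbb E[a^*(t)]$ over the $(s,y,\gamma)$-only policies with $\mathbb E[b^*(t)p^*(t)a^*(t)-\gamma(t)x^*(t)]=\phi^*$ and $\mathbb E[a^*(t)-s(t)-x^*(t)]\le0$.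 **Theorem 2.** Assume $x_{\max}\ge\max[a_{\max},\epsilon]$, and let the joint pricing and allocation policy be used in every slot with fixed parameters $\epsilon\ge0$ and $V>0$. Then: (a) On every sample path (the states need not be i.i.d.), for all $t$, $Q(t)\le V\gamma_{\max}+a_{\max}$ and $Z(t)\le V\gamma_{\max}+\epsilon$; and if $\epsilon>0$, every request is served with a delay of at most $\lceil(2V\gamma_{\max}+a_{\max}+\epsilon)/\epsilon\rceil$ slots. (b) If $(s(t),y(t),\gamma(t))$ is i.i.d. over slots as above and $\epsilon\le\max[a^*,\mathbb E[s(t)]]$, then for every $t>0$ $$\frac1t\sum_{\tau=0}^{t-1}\mathbb E[\phi(\tau)]\ \ge\ \phi^*-\frac BV,\qquad B=\frac{(s_{\max}+x_{\max})^2+a_{\max}^2}{2}+\frac{\max[\epsilon^2,(s_{\max}+x_{\max})^2]}{2}.$$ -/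

import Mathlib

open MeasureTheory ProbabilityTheory Set Filter Topology

universe u

/-- The constants and the demand function of the renewable energy supplier's problem.
`Y` is the space of demand states. `F p y γ` is the expected amount of energy requested in a slot
in which requests are accepted at price `p`, in demand state `y`, at market price `γ`. It is
continuous in the price, and it takes values in `[0, aMax]`, being the mean of requests that are
always in `[0, aMax]`. -/
structure EnergyMarket (Y : Type u) [MeasurableSpace Y] where
  /-- bound on the renewable supply per slot -/
  sMax : ℝ
  /-- bound on the requests per slot -/
  aMax : ℝ
  /-- bound on the market price -/
  γMax : ℝ
  /-- bound on the outside purchase per slot -/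
  xMax : ℝ
  /-- largest price that the supplier may set -/
  pMax : ℝ
  /-- the demand function -/
  F : ℝ → Y → ℝ → ℝ
  measurable_F : Measurable fun w : ℝ × Y × ℝ => F w.1 w.2.1 w.2.2
  continuousOn_F : ∀ y, ∀ γ ∈ Icc 0 γMax, ContinuousOn (fun p => F p y γ) (Icc 0 pMax)
  F_mem : ∀ p ∈ Icc 0 pMax, ∀ y, ∀ γ ∈ Icc 0 γMax, F p y γ ∈ Icc 0 aMax

/-- The exogenous processes, the decisions and the requests, slot by slot, on a sample space. -/
structure EnergySystem (Ω Y : Type u) where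
  /-- renewable supply -/
  s : ℕ → Ω → ℝ
  /-- demand state -/
  y : ℕ → Ω → Y
  /-- market price of outside energy -/
  γ : ℕ → Ω → ℝ
  /-- outside energy purchased -/
  x : ℕ → Ω → ℝ
  /-- acceptance decision, `1` (accept requests) or `0` (accept none) -/
  b : ℕ → Ω → ℝ
  /-- price set by the supplier -/
  p : ℕ → Ω → ℝ
  /-- requests that arrive -/
  a : ℕ → Ω → ℝ

namespace EnergySystem

variable {Ω Y : Type u}

/-- The queue backlog, started empty: `Q(t+1) = max[Q(t) - s(t) - x(t), 0] + a(t)`. -/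
noncomputable def Q (S : EnergySystem Ω Y) : ℕ → Ω → ℝ
  | 0, _ => 0
  | t + 1, ω => max (S.Q t ω - S.s t ω - S.x t ω) 0 + S.a t ω

open Classical in
/-- The delay-aware virtual queue with parameter `ε`, started empty:
`Z(t+1) = max[Z(t) - s(t) - x(t) + ε 1{Q(t) > 0}, 0]`. -/
noncomputable def Z (S : EnergySystem Ω Y) (ε : ℝ) : ℕ → Ω → ℝ
  | 0, _ => 0
  | t + 1, ω =>
      max (S.Z ε t ω - S.s t ω - S.x t ω + ε * (if 0 < S.Q t ω then 1 else 0)) 0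

/-- The profit `φ(t) = b(t) p(t) a(t) - γ(t) x(t)`. -/
def profit (S : EnergySystem Ω Y) (t : ℕ) (ω : Ω) : ℝ :=
  S.b t ω * S.p t ω * S.a t ω - S.γ t ω * S.x t ω

/-- The total of the requests that arrived before slot `t`. -/
def arrived (S : EnergySystem Ω Y) (t : ℕ) (ω : Ω) : ℝ :=
  ∑ τ ∈ Finset.range t, S.a τ ω

/-- The total of the requests that were served before slot `t`; in slot `τ` the queue holds
`Q(τ)`, and `s(τ) + x(τ)` units of energy are offered to it. -/
noncomputable def served (S : EnergySystem Ω Y) (t : ℕ) (ω : Ω) : ℝ :=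
  ∑ τ ∈ Finset.range t, min (S.Q τ ω) (S.s τ ω + S.x τ ω)

/-- Under first-in-first-out service every request has a delay of at most `D` slots.
The units of requested energy are ranked in their order of arrival: those of slot `t` have
the ranks `r` in `(arrived t, arrived (t + 1)]`. As service is first-in-first-out, the unit of
rank `r` is served in the slot `τ` with `served τ < r ≤ served (τ + 1)`; its delay is `τ - t`. -/
def FifoDelayLE (S : EnergySystem Ω Y) (D : ℕ) (ω : Ω) : Prop :=
  ∀ (t : ℕ) (r : ℝ), r ∈ Ioc (S.arrived t ω) (S.arrived (t + 1) ω) →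
    ∃ τ, τ ≤ t + D ∧ r ∈ Ioc (S.served τ ω) (S.served (τ + 1) ω)

variable [MeasurableSpace Ω] [MeasurableSpace Y]

/-- All processes are measurable, the exogenous processes and the requests keep to their
bounds, the decisions satisfy their constraints, and no requests arrive when none are accepted. -/
structure IsFeasible (S : EnergySystem Ω Y) (M : EnergyMarket Y) : Prop where
  measurable_s : ∀ t, Measurable (S.s t)
  measurable_y : ∀ t, Measurable (S.y t)
  measurable_γ : ∀ t, Measurable (S.γ t)
  measurable_x : ∀ t, Measurable (S.x t)
  measurable_b : ∀ t, Measurable (S.b t)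
  measurable_p : ∀ t, Measurable (S.p t)
  measurable_a : ∀ t, Measurable (S.a t)
  s_mem : ∀ t ω, S.s t ω ∈ Icc 0 M.sMax
  γ_mem : ∀ t ω, S.γ t ω ∈ Icc 0 M.γMax
  a_mem : ∀ t ω, S.a t ω ∈ Icc 0 M.aMax
  x_mem : ∀ t ω, S.x t ω ∈ Icc 0 M.xMax
  b_mem : ∀ t ω, S.b t ω ∈ ({0, 1} : Set ℝ)
  p_mem : ∀ t ω, S.p t ω ∈ Icc 0 M.pMax
  a_eq_zero : ∀ t ω, S.b t ω = 0 → S.a t ω = 0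

open Classical in
/-- In every slot the decisions are those of the joint pricing and allocation policy with
parameters `V` and `ε`: the price maximizes `F(p, y(t), γ(t)) (V p - Q(t))` over `[0, pMax]`,
requests are accepted if and only if the maximum is nonnegative, and `xMax` is purchased
unless `Q(t) + Z(t) ≤ V γ(t)`, when nothing is. -/
structure FollowsJointPolicy (S : EnergySystem Ω Y) (M : EnergyMarket Y) (V ε : ℝ) : Prop where
  price_mem : ∀ t ω, S.p t ω ∈ Icc 0 M.pMax
  price_max : ∀ t ω, ∀ q ∈ Icc 0 M.pMax,
    M.F q (S.y t ω) (S.γ t ω) * (V * q - S.Q t ω)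
      ≤ M.F (S.p t ω) (S.y t ω) (S.γ t ω) * (V * S.p t ω - S.Q t ω)
  accept : ∀ t ω, S.b t ω =
    if 0 ≤ M.F (S.p t ω) (S.y t ω) (S.γ t ω) * (V * S.p t ω - S.Q t ω) then 1 else 0
  allocate : ∀ t ω, S.x t ω = if S.Q t ω + S.Z ε t ω ≤ V * S.γ t ω then 0 else M.xMax

/-- The exogenous state `(s(t), y(t), γ(t))`. -/
def state (S : EnergySystem Ω Y) (t : ℕ) (ω : Ω) : ℝ × Y × ℝ :=
  (S.s t ω, S.y t ω, S.γ t ω)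

/-- The decisions `(x(t), b(t), p(t))`. -/
def decision (S : EnergySystem Ω Y) (t : ℕ) (ω : Ω) : ℝ × ℝ × ℝ :=
  (S.x t ω, S.b t ω, S.p t ω)

/-- The history before slot `t`: all states, decisions and requests of the earlier slots. -/
@[reducible] def past (S : EnergySystem Ω Y) (t : ℕ) : MeasurableSpace Ω :=
  ⨆ τ : Fin t, MeasurableSpace.comap
    (fun ω => (S.state τ ω, S.decision τ ω, S.a τ ω)) inferInstance

/-- What is settled before the requests of slot `t` arrive: the history before slot `t`, and the
state and the decisions of slot `t`. -/
@[reducible] def present (S : EnergySystem Ω Y) (t : ℕ) : MeasurableSpace Ω :=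
  S.past t ⊔ MeasurableSpace.comap (fun ω => (S.state t ω, S.decision t ω)) inferInstance

/-- The states `(s(t), y(t), γ(t))` are i.i.d. over slots with law `π`: each has law `π` and is
independent of the history of the system before its slot, in particular of the earlier states.
So no decision and no request anticipates a later state; a decision may depend on the whole
history, on the present state and on additional randomization. -/
structure HasIIDStates (S : EnergySystem Ω Y) (μ : Measure Ω) (π : Measure (ℝ × Y × ℝ)) :
    Prop where
  law : ∀ t, μ.map (S.state t) = π
  indep : ∀ t, Indep (S.past t) (MeasurableSpace.comap (S.state t) inferInstance) μ

/-- The requests follow the demand function: given the history, the present state and the present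
decisions, the mean of the requests is `F(p(t), y(t), γ(t))` if `b(t) = 1`, and zero if
`b(t) = 0`. -/
def HasDemand (S : EnergySystem Ω Y) (M : EnergyMarket Y) (μ : Measure Ω) : Prop :=
  ∀ t, μ[S.a t | S.present t] =ᵐ[μ]
    fun ω => S.b t ω * M.F (S.p t ω) (S.y t ω) (S.γ t ω)

/-- The expected time-average profit over the slots before `t`. -/
noncomputable def avgProfit (S : EnergySystem Ω Y) (μ : Measure Ω) (t : ℕ) : ℝ :=
  (1 / (t : ℝ)) * ∑ τ ∈ Finset.range t, ∫ ω, S.profit τ ω ∂μ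

/-- The time-average expected backlog, a `limsup` that may be infinite. -/
noncomputable def avgBacklog (S : EnergySystem Ω Y) (μ : Measure Ω) : EReal :=
  limsup (fun t : ℕ =>
    (((1 / (t : ℝ)) * ∑ τ ∈ Finset.range t, ∫ ω, S.Q τ ω ∂μ : ℝ) : EReal)) atTop

end EnergySystem

namespace EnergyMarket

variable {Y : Type u} [MeasurableSpace Y]

/-- The limiting time-average profits of all algorithms that satisfy the constraints of the
profit maximization problem, among them finite time-average expected backlog, when the states are
i.i.d. with law `π`. -/
def achievableProfit (M : EnergyMarket Y) (π : Measure (ℝ × Y × ℝ)) : Set ℝ :=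
  {v | ∃ (Ω : Type u) (_ : MeasurableSpace Ω) (μ : Measure Ω) (S : EnergySystem Ω Y),
    IsProbabilityMeasure μ ∧ S.IsFeasible M ∧ S.HasIIDStates μ π ∧ S.HasDemand M μ ∧
      S.avgBacklog μ < ⊤ ∧ Tendsto (S.avgProfit μ) atTop (𝓝 v)}

/-- The optimal time-average profit `φ*`. -/
noncomputable def phiStar (M : EnergyMarket Y) (π : Measure (ℝ × Y × ℝ)) : ℝ :=
  sSup (M.achievableProfit π)

/-- A policy that depends only on the present state `(s, y, γ)`: a stationary randomized choice of
`(x, b, p)`, subject to the constraints, with law `κ (s, y, γ)`. -/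
structure IsStateOnlyPolicy (M : EnergyMarket Y) (π : Measure (ℝ × Y × ℝ))
    (κ : Kernel (ℝ × Y × ℝ) (ℝ × ℝ × ℝ)) : Prop where
  markov : IsMarkovKernel κ
  constraints : ∀ᵐ w ∂π, ∀ᵐ d ∂(κ w),
    d.1 ∈ Icc 0 M.xMax ∧ d.2.1 ∈ ({0, 1} : Set ℝ) ∧ d.2.2 ∈ Icc 0 M.pMax

/-- The mean request `b F(p, y, γ)` of a slot with state `w = (s, y, γ)` and decisions
`d = (x, b, p)`. -/
def meanRequest (M : EnergyMarket Y) (w : ℝ × Y × ℝ) (d : ℝ × ℝ × ℝ) : ℝ :=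
  d.2.1 * M.F d.2.2 w.2.1 w.2.2

/-- The expected requests per slot under a state-only policy. -/
noncomputable def expectedRequest (M : EnergyMarket Y) (π : Measure (ℝ × Y × ℝ))
    (κ : Kernel (ℝ × Y × ℝ) (ℝ × ℝ × ℝ)) : ℝ :=
  ∫ z, M.meanRequest z.1 z.2 ∂(π ⊗ₘ κ)

/-- The expected profit per slot under a state-only policy: the mean of `p a - γ x`, where `a` has
conditional mean `b F(p, y, γ)` given the state and the decisions. -/
noncomputable def expectedProfit (M : EnergyMarket Y) (π : Measure (ℝ × Y × ℝ))
    (κ : Kernel (ℝ × Y × ℝ) (ℝ × ℝ × ℝ)) : ℝ :=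
  ∫ z, (z.2.2.2 * M.meanRequest z.1 z.2 - z.1.2.2 * z.2.1) ∂(π ⊗ₘ κ)

/-- The expected excess `a - s - x` of requests over service per slot under a state-only policy. -/
noncomputable def expectedExcess (M : EnergyMarket Y) (π : Measure (ℝ × Y × ℝ))
    (κ : Kernel (ℝ × Y × ℝ) (ℝ × ℝ × ℝ)) : ℝ :=
  ∫ z, (M.meanRequest z.1 z.2 - z.1.1 - z.2.1) ∂(π ⊗ₘ κ)

/-- The largest expected requests per slot `a*` among the state-only policies whose expected
profit is `φ*` and whose expected requests are at most the expected service. -/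
noncomputable def aStar (M : EnergyMarket Y) (π : Measure (ℝ × Y × ℝ)) : ℝ :=
  sSup {r | ∃ κ : Kernel (ℝ × Y × ℝ) (ℝ × ℝ × ℝ), M.IsStateOnlyPolicy π κ ∧
    M.expectedProfit π κ = M.phiStar π ∧ M.expectedExcess π κ ≤ 0 ∧
    M.expectedRequest π κ = r}

/-- The constant `B` of the drift bound. -/
noncomputable def driftConst (M : EnergyMarket Y) (ε : ℝ) : ℝ :=
  ((M.sMax + M.xMax) ^ 2 + M.aMax ^ 2) / 2 + max (ε ^ 2) ((M.sMax + M.xMax) ^ 2) / 2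

end EnergyMarket

/-!
The worst-case bounds are an induction: the policy purchases `xMax`, which covers `aMax` and `ε`,
as soon as one of the queues exceeds `V γMax`. For the delay, all offered energy is used as long as
a given request waits, so the virtual queue gains `ε` less that energy in every slot
(`EnergySystem.IsFeasible.Z_ge_of_waiting`). The energy used in that time is at most the backlog
found on arrival, and the virtual queue is bounded, so the wait cannot be long.

The profit bound is a Lyapunov drift argument with the function `(Q² + Z²) / 2`. Its drift less `V`
times the profit is at most `B` plus the terms of `EnergyMarket.penalizedDrift`, which the policy
minimizes pointwise over all decisions (`EnergySystem.FollowsJointPolicy.penalizedDrift_le`). It can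
therefore be compared with decisions drawn from any state-only policy `κ` at the present state. The
present state is independent of the backlogs, so the comparison value factors into
`E[Q] (excess of κ) + E[Z] (ε - service of κ) - V (profit of κ)`. With bounded backlogs, summing
over slots gives `EnergySystem.IsFeasible.expectedProfit_le_avgProfit`: the joint policy falls short
of `κ` by at most `B / V`, plus a multiple of the amount `δ` by which `κ` violates
`excess ≤ 0` and `ε ≤ service`.

It remains to supply policies `κ`. If `ε ≤ E[s]`, the service of any policy is at least `ε`. For an
arbitrary admissible algorithm the joint law of state and decisions, averaged over the first `T`
slots and disintegrated over the state, is a state-only policy with the average profit of the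
algorithm and excess at most `E[Q(T)] / T`. As the average backlog is finite, this is small for
arbitrarily large `T` (`EnergySystem.exists_stateOnly_of_mem_achievableProfit`). If
`E[s] < ε ≤ a*`, policies with profit `φ*`, no excess and requests close to `a*` are available by
definition of `a*`, and their service is at least their requests.
-/

/-! ### Queues along a sample path -/

namespace EnergySystem

variable {Ω Y : Type u} {S : EnergySystem Ω Y}

lemma arrived_succ (t : ℕ) (ω : Ω) : S.arrived (t + 1) ω = S.arrived t ω + S.a t ω :=
  Finset.sum_range_succ _ _

lemma served_succ (t : ℕ) (ω : Ω) :
    S.served (t + 1) ω = S.served t ω + min (S.Q t ω) (S.s t ω + S.x t ω) :=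
  Finset.sum_range_succ _ _

/-- The backlog consists of the requests that have arrived and are not yet served. -/
lemma Q_eq_arrived_sub_served (t : ℕ) (ω : Ω) : S.Q t ω = S.arrived t ω - S.served t ω := by
  induction t with
  | zero => simp [Q, arrived, served]
  | succ t ih =>
    rw [arrived_succ, served_succ, Q]
    rcases le_total (S.Q t ω) (S.s t ω + S.x t ω) with h | h
    · rw [min_eq_left h, max_eq_right (by linarith)]; linarith
    · rw [min_eq_right h, max_eq_left (by linarith)]; linarith

lemma Z_nonneg (S : EnergySystem Ω Y) (ε : ℝ) (t : ℕ) (ω : Ω) : 0 ≤ S.Z ε t ω := by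
  cases t with
  | zero => simp [Z]
  | succ t => exact le_max_right _ _

lemma Q_add_sub_le_Q_succ (S : EnergySystem Ω Y) (t : ℕ) (ω : Ω) :
    S.Q t ω + (S.a t ω - S.s t ω - S.x t ω) ≤ S.Q (t + 1) ω := by
  rw [Q]; linarith [le_max_left (S.Q t ω - S.s t ω - S.x t ω) 0]

variable [MeasurableSpace Ω] [MeasurableSpace Y] {M : EnergyMarket Y} {V ε : ℝ}

namespace IsFeasible

lemma Q_nonneg (hS : S.IsFeasible M) (t : ℕ) (ω : Ω) : 0 ≤ S.Q t ω := by
  cases t with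
  | zero => simp [Q]
  | succ t => exact add_nonneg (le_max_right _ _) (hS.a_mem t ω).1

lemma Q_le (hS : S.IsFeasible M) (t : ℕ) (ω : Ω) : S.Q t ω ≤ t * M.aMax := by
  induction t with
  | zero => simp [Q]
  | succ t ih =>
    have := hS.Q_nonneg t ω
    have h : max (S.Q t ω - S.s t ω - S.x t ω) 0 ≤ S.Q t ω :=
      max_le (by linarith [(hS.s_mem t ω).1, (hS.x_mem t ω).1]) this
    rw [Q]; push_cast; linarith [(hS.a_mem t ω).2]

lemma Q_le_of_joint (hS : S.IsFeasible M) (hpol : S.FollowsJointPolicy M V ε) (hV : 0 < V)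
    (hx : M.aMax ≤ M.xMax) (t : ℕ) (ω : Ω) : S.Q t ω ≤ V * M.γMax + M.aMax := by
  have h0 : 0 ≤ V * M.γMax := mul_nonneg hV.le ((hS.γ_mem t ω).1.trans (hS.γ_mem t ω).2)
  induction t with
  | zero =>
    have ha := hS.a_mem 0 ω
    rw [Q]; linarith [ha.1, ha.2]
  | succ t ih =>
    have ha := hS.a_mem t ω
    have hs := hS.s_mem t ω
    have hxm := hS.x_mem t ω
    have h1 := mul_le_mul_of_nonneg_left (hS.γ_mem t ω).2 hV.le
    rw [Q, max_add]
    refine max_le ?_ (by linarith [ha.2])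
    by_cases hQ : S.Q t ω ≤ V * M.γMax
    · linarith [hs.1, hxm.1, ha.2]
    · have hxe := hpol.allocate t ω
      rw [if_neg (by linarith [S.Z_nonneg ε t ω])] at hxe
      linarith [hs.1, ha.2]

lemma Z_le_of_joint (hS : S.IsFeasible M) (hpol : S.FollowsJointPolicy M V ε) (hV : 0 < V)
    (hε : 0 ≤ ε) (hx : ε ≤ M.xMax) (t : ℕ) (ω : Ω) : S.Z ε t ω ≤ V * M.γMax + ε := by
  have h0 : 0 ≤ V * M.γMax := mul_nonneg hV.le ((hS.γ_mem t ω).1.trans (hS.γ_mem t ω).2)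
  induction t with
  | zero => rw [Z]; linarith
  | succ t ih =>
    have hs := hS.s_mem t ω
    have h1 := mul_le_mul_of_nonneg_left (hS.γ_mem t ω).2 hV.le
    have hi : ε * (if 0 < S.Q t ω then 1 else 0) ≤ ε := by split_ifs <;> simp [hε]
    rw [Z]
    refine max_le ?_ (by linarith)
    by_cases hZ : S.Z ε t ω ≤ V * M.γMax
    · linarith [hs.1, (hS.x_mem t ω).1]
    · have hxe := hpol.allocate t ω
      rw [if_neg (by linarith [hS.Q_nonneg t ω])] at hxe
      linarith [hs.1]

lemma arrived_mono (hS : S.IsFeasible M) (ω : Ω) : Monotone fun t => S.arrived t ω :=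
  monotone_nat_of_le_succ fun t => by rw [arrived_succ]; linarith [(hS.a_mem t ω).1]

lemma served_mono (hS : S.IsFeasible M) (ω : Ω) : Monotone fun t => S.served t ω :=
  monotone_nat_of_le_succ fun t => by
    rw [served_succ]
    have := le_min (hS.Q_nonneg t ω) (add_nonneg (hS.s_mem t ω).1 (hS.x_mem t ω).1)
    linarith

/-- While a request that arrived before slot `m` waits, all the energy offered is used and the
virtual queue grows by `ε` less that energy in every slot. -/
lemma Z_ge_of_waiting (hS : S.IsFeasible M) {ω : Ω} {m n : ℕ}
    (hwait : S.served (m + n) ω < S.arrived m ω) :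
    S.Z ε m ω + n * ε - (S.served (m + n) ω - S.served m ω) ≤ S.Z ε (m + n) ω := by
  induction n with
  | zero => simp
  | succ n ih =>
    have hmono : S.served (m + n) ω ≤ S.served (m + n + 1) ω := hS.served_mono ω (Nat.le_succ _)
    have hle : S.arrived m ω ≤ S.arrived (m + n) ω := hS.arrived_mono ω (Nat.le_add_right _ _)
    rw [← add_assoc] at hwait
    specialize ih (hmono.trans_lt hwait)
    have hQ := S.Q_eq_arrived_sub_served (m + n) ω
    have hQpos : 0 < S.Q (m + n) ω := by linarith
    have hs := S.served_succ (m + n) ω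
    have hlt : min (S.Q (m + n) ω) (S.s (m + n) ω + S.x (m + n) ω) < S.Q (m + n) ω := by linarith
    have hmin : min (S.Q (m + n) ω) (S.s (m + n) ω + S.x (m + n) ω)
        = S.s (m + n) ω + S.x (m + n) ω :=
      min_eq_right (by by_contra! h; rw [min_eq_left h.le] at hlt; exact hlt.false)
    rw [← add_assoc, Z, if_pos hQpos]
    push_cast
    refine le_trans ?_ (le_max_left _ _)
    linarith

/-- Bounded actual and virtual backlogs bound the delay: a request waiting for `D` slots makes
the virtual queue gain `D ε` less the energy served, which is at most the backlog found by the
request on its arrival. -/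
lemma fifoDelayLE (hS : S.IsFeasible M) (hε : 0 < ε) {ω : Ω} {Qm Zm : ℝ}
    (hQ : ∀ t, S.Q t ω ≤ Qm) (hZ : ∀ t, S.Z ε t ω ≤ Zm) :
    S.FifoDelayLE ⌈(Qm + Zm) / ε⌉₊ ω := by
  intro t r hr
  set D := ⌈(Qm + Zm) / ε⌉₊
  have hD : Qm + Zm ≤ D * ε := (div_le_iff₀ hε).1 (Nat.le_ceil _)
  have hserved : r ≤ S.served (t + 1 + D) ω := by
    by_contra! hlt
    have h1 := hS.Z_ge_of_waiting (ε := ε) (hlt.trans_le hr.2)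
    have h2 := S.Q_eq_arrived_sub_served (t + 1) ω
    linarith [hQ (t + 1), hZ (t + 1 + D), S.Z_nonneg ε (t + 1) ω, hr.2]
  have hex : ∃ n, r ≤ S.served n ω := ⟨_, hserved⟩
  classical
  have hpos : Nat.find hex ≠ 0 := fun h0 => by
    have h1 := Nat.find_spec hex
    have h2 : S.arrived 0 ω ≤ S.arrived t ω := hS.arrived_mono ω (Nat.zero_le t)
    rw [h0] at h1
    simp only [served, arrived, Finset.range_zero, Finset.sum_empty] at h1 h2
    have h3 : S.arrived t ω < r := hr.1
    simp only [arrived] at h3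
    linarith
  obtain ⟨τ, hτ⟩ := Nat.exists_eq_succ_of_ne_zero hpos
  refine ⟨τ, ?_, not_le.1 (Nat.find_min hex (by omega)), ?_⟩
  · have := Nat.find_min' hex hserved
    omega
  · have := Nat.find_spec hex
    rwa [hτ] at this

end IsFeasible

end EnergySystem

/-! ### Drift plus penalty -/

namespace EnergyMarket

variable {Y : Type u} [MeasurableSpace Y]

/-- The part of the drift-plus-penalty bound that depends on the state `w = (s, y, γ)` and the
decisions `d = (x, b, p)` of a slot, at backlog `q` and virtual backlog `z`, with the requests
replaced by their mean. -/
def penalizedDrift (M : EnergyMarket Y) (V ε q z : ℝ) (w : ℝ × Y × ℝ) (d : ℝ × ℝ × ℝ) : ℝ :=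
  q * (M.meanRequest w d - w.1 - d.1) + z * (ε - (w.1 + d.1))
    - V * (d.2.2 * M.meanRequest w d - w.2.2 * d.1)

lemma measurable_meanRequest (M : EnergyMarket Y) :
    Measurable fun z : (ℝ × Y × ℝ) × (ℝ × ℝ × ℝ) => M.meanRequest z.1 z.2 := by
  have h : Measurable fun z : (ℝ × Y × ℝ) × (ℝ × ℝ × ℝ) => M.F z.2.2.2 z.1.2.1 z.1.2.2 :=
    M.measurable_F.comp (g := fun w : ℝ × Y × ℝ => M.F w.1 w.2.1 w.2.2)
      (f := fun z : (ℝ × Y × ℝ) × (ℝ × ℝ × ℝ) => (z.2.2.2, z.1.2.1, z.1.2.2)) (by fun_prop)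
  unfold meanRequest
  fun_prop

/-- The state `z.1 = (s, y, γ)` and the decisions `z.2 = (x, b, p)` of a slot meet their
constraints. -/
def Admissible (M : EnergyMarket Y) (z : (ℝ × Y × ℝ) × (ℝ × ℝ × ℝ)) : Prop :=
  (z.1.1 ∈ Icc 0 M.sMax ∧ z.1.2.2 ∈ Icc 0 M.γMax) ∧
    z.2.1 ∈ Icc 0 M.xMax ∧ z.2.2.1 ∈ ({0, 1} : Set ℝ) ∧ z.2.2.2 ∈ Icc 0 M.pMax

lemma measurableSet_admissible (M : EnergyMarket Y) : MeasurableSet {z | M.Admissible z} := by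
  refine .inter (.inter ?_ ?_) (.inter ?_ (.inter ?_ ?_))
  · exact measurableSet_Icc.preimage (by fun_prop : Measurable
      fun z : (ℝ × Y × ℝ) × (ℝ × ℝ × ℝ) => z.1.1)
  · exact measurableSet_Icc.preimage (by fun_prop : Measurable
      fun z : (ℝ × Y × ℝ) × (ℝ × ℝ × ℝ) => z.1.2.2)
  · exact measurableSet_Icc.preimage (by fun_prop : Measurable
      fun z : (ℝ × Y × ℝ) × (ℝ × ℝ × ℝ) => z.2.1)
  · exact (toFinite ({0, 1} : Set ℝ)).measurableSet.preimage (by fun_prop : Measurable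
      fun z : (ℝ × Y × ℝ) × (ℝ × ℝ × ℝ) => z.2.2.1)
  · exact measurableSet_Icc.preimage (by fun_prop : Measurable
      fun z : (ℝ × Y × ℝ) × (ℝ × ℝ × ℝ) => z.2.2.2)

lemma Admissible.meanRequest_mem {M : EnergyMarket Y} {z : (ℝ × Y × ℝ) × (ℝ × ℝ × ℝ)}
    (h : M.Admissible z) : M.meanRequest z.1 z.2 ∈ Icc 0 M.aMax := by
  obtain ⟨⟨-, hγ⟩, -, hb, hp⟩ := h
  have hF := M.F_mem _ hp z.1.2.1 _ hγ
  rcases hb with hb | hb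
  · rw [meanRequest, hb, zero_mul]; exact ⟨le_rfl, hF.1.trans hF.2⟩
  · rw [mem_singleton_iff] at hb
    rw [meanRequest, hb, one_mul]; exact hF

end EnergyMarket

namespace EnergySystem

variable {Ω Y : Type u} {S : EnergySystem Ω Y} [MeasurableSpace Y]
  {M : EnergyMarket Y} {V ε : ℝ}

/-- The joint policy minimizes the drift-plus-penalty bound over all admissible decisions: price
and acceptance minimize the terms in the requests, the allocation those in the purchase. -/
lemma FollowsJointPolicy.penalizedDrift_le (hpol : S.FollowsJointPolicy M V ε) (t : ℕ) (ω : Ω)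
    {d : ℝ × ℝ × ℝ} (hd : M.Admissible (S.state t ω, d)) :
    M.penalizedDrift V ε (S.Q t ω) (S.Z ε t ω) (S.state t ω) (S.decision t ω)
      ≤ M.penalizedDrift V ε (S.Q t ω) (S.Z ε t ω) (S.state t ω) d := by
  obtain ⟨-, hx, hb, hp⟩ := hd
  have hmax := hpol.price_max t ω _ hp
  have hrequest : d.2.1 * (M.F d.2.2 (S.y t ω) (S.γ t ω) * (V * d.2.2 - S.Q t ω))
      ≤ S.b t ω * (M.F (S.p t ω) (S.y t ω) (S.γ t ω) * (V * S.p t ω - S.Q t ω)) := by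
    rw [hpol.accept t ω]
    simp only [mem_insert_iff, mem_singleton_iff] at hb
    rcases hb with hb | hb <;> rw [hb] <;> split_ifs with h <;> linarith
  have hpurchase : S.x t ω * (V * S.γ t ω - (S.Q t ω + S.Z ε t ω))
      ≤ d.1 * (V * S.γ t ω - (S.Q t ω + S.Z ε t ω)) := by
    rw [hpol.allocate t ω]
    split_ifs with h
    · rw [zero_mul]; exact mul_nonneg hx.1 (by linarith)
    · exact mul_le_mul_of_nonpos_right hx.2 (by linarith)
  simp only [EnergyMarket.penalizedDrift, EnergyMarket.meanRequest, state, decision]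
  linarith

variable [MeasurableSpace Ω]

lemma IsFeasible.admissible (hS : S.IsFeasible M) (t : ℕ) (ω : Ω) :
    M.Admissible (S.state t ω, S.decision t ω) :=
  ⟨⟨hS.s_mem t ω, hS.γ_mem t ω⟩, hS.x_mem t ω, hS.b_mem t ω, hS.p_mem t ω⟩

/-- The quadratic Lyapunov function of the two queues. -/
noncomputable def lyapunov (S : EnergySystem Ω Y) (ε : ℝ) (t : ℕ) (ω : Ω) : ℝ :=
  (S.Q t ω ^ 2 + S.Z ε t ω ^ 2) / 2

lemma IsFeasible.lyapunov_drift_le (hS : S.IsFeasible M) (hε : 0 ≤ ε) (t : ℕ) (ω : Ω) :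
    S.lyapunov ε (t + 1) ω - S.lyapunov ε t ω ≤ M.driftConst ε
      + S.Q t ω * (S.a t ω - S.s t ω - S.x t ω) + S.Z ε t ω * (ε - (S.s t ω + S.x t ω)) := by
  have hs := hS.s_mem t ω
  have hx := hS.x_mem t ω
  have ha := hS.a_mem t ω
  have hQ := hS.Q_nonneg t ω
  have hZ := S.Z_nonneg ε t ω
  have hQ1 : S.Q (t + 1) ω = max (S.Q t ω - S.s t ω - S.x t ω) 0 + S.a t ω := rfl
  have hZ1 : S.Z ε (t + 1) ω = max (S.Z ε t ω - S.s t ω - S.x t ω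
    + ε * (if 0 < S.Q t ω then 1 else 0)) 0 := rfl
  have hi : 0 ≤ ε * (if 0 < S.Q t ω then (1 : ℝ) else 0) ∧
      ε * (if 0 < S.Q t ω then (1 : ℝ) else 0) ≤ ε := by split_ifs <;> simp [hε]
  rw [lyapunov, lyapunov, hQ1, hZ1, EnergyMarket.driftConst]
  generalize ε * (if 0 < S.Q t ω then (1 : ℝ) else 0) = e at hi ⊢
  generalize S.Q t ω = q at *
  generalize S.Z ε t ω = z at *
  generalize S.a t ω = a at *
  obtain ⟨c, hc⟩ : ∃ c, c = S.s t ω + S.x t ω := ⟨_, rfl⟩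
  have hc0 : 0 ≤ c := by linarith [hs.1, hx.1]
  have hcm : c ^ 2 ≤ (M.sMax + M.xMax) ^ 2 := by
    apply pow_le_pow_left₀ hc0; linarith [hs.2, hx.2]
  have ham : a ^ 2 ≤ M.aMax ^ 2 := pow_le_pow_left₀ ha.1 ha.2 2
  have hmaxsq (r : ℝ) : max r 0 ^ 2 ≤ r ^ 2 := by
    rcases le_total r 0 with h | h
    · rw [max_eq_right h, zero_pow two_ne_zero]; exact sq_nonneg r
    · rw [max_eq_left h]
  have hq : max (q - c) 0 * a ≤ q * a :=
    mul_le_mul_of_nonneg_right (max_le (by linarith) hQ) ha.1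
  have h1 := hmaxsq (q - c)
  have h2 := hmaxsq (z - c + e)
  -- both `e` and `c` are nonnegative, so the larger one bounds their difference
  have h3 : (e - c) ^ 2 ≤ max (ε ^ 2) ((M.sMax + M.xMax) ^ 2) := by
    rcases le_total e c with h | h
    · exact le_max_of_le_right (by nlinarith)
    · exact le_max_of_le_left (by nlinarith)
  have h4 : z * e ≤ z * ε := mul_le_mul_of_nonneg_left hi.2 hZ
  rw [show q - S.s t ω - S.x t ω = q - c by rw [hc]; ring,
    show z - S.s t ω - S.x t ω = z - c by rw [hc]; ring,
    show a - S.s t ω - S.x t ω = a - c by rw [hc]; ring, ← hc]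
  nlinarith

end EnergySystem

/-! ### Measurability and integrability -/

lemma memLp_top_of_ae_mem_Icc {α : Type*} [MeasurableSpace α] {μ : Measure α} {f : α → ℝ}
    {c : ℝ} (hf : Measurable f) (hc : ∀ᵐ z ∂μ, f z ∈ Icc 0 c) : MemLp f ⊤ μ :=
  memLp_top_of_bound hf.aestronglyMeasurable c <| hc.mono fun z hz => by
    rw [Real.norm_of_nonneg hz.1]; exact hz.2

namespace EnergyMarket

variable {Y : Type u} [MeasurableSpace Y] {M : EnergyMarket Y}
  {ρ : Measure ((ℝ × Y × ℝ) × (ℝ × ℝ × ℝ))}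

lemma memLp_meanRequest (hρ : ∀ᵐ z ∂ρ, M.Admissible z) :
    MemLp (fun z => M.meanRequest z.1 z.2) ⊤ ρ :=
  memLp_top_of_ae_mem_Icc M.measurable_meanRequest (hρ.mono fun _ hz => hz.meanRequest_mem)

lemma memLp_supply (hρ : ∀ᵐ z ∂ρ, M.Admissible z) : MemLp (fun z => z.1.1) ⊤ ρ :=
  memLp_top_of_ae_mem_Icc (by fun_prop) (hρ.mono fun _ hz => hz.1.1)

lemma memLp_purchase (hρ : ∀ᵐ z ∂ρ, M.Admissible z) : MemLp (fun z => z.2.1) ⊤ ρ :=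
  memLp_top_of_ae_mem_Icc (by fun_prop) (hρ.mono fun _ hz => hz.2.1)

lemma memLp_service (hρ : ∀ᵐ z ∂ρ, M.Admissible z) : MemLp (fun z => z.1.1 + z.2.1) ⊤ ρ :=
  (memLp_supply hρ).add (memLp_purchase hρ)

lemma memLp_excess (hρ : ∀ᵐ z ∂ρ, M.Admissible z) :
    MemLp (fun z => M.meanRequest z.1 z.2 - z.1.1 - z.2.1) ⊤ ρ :=
  ((memLp_meanRequest hρ).sub (memLp_supply hρ)).sub (memLp_purchase hρ)

lemma measurable_meanProfit (M : EnergyMarket Y) :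
    Measurable fun z : (ℝ × Y × ℝ) × (ℝ × ℝ × ℝ) =>
      z.2.2.2 * M.meanRequest z.1 z.2 - z.1.2.2 * z.2.1 := by
  have := M.measurable_meanRequest
  fun_prop

lemma memLp_meanProfit (hρ : ∀ᵐ z ∂ρ, M.Admissible z) :
    MemLp (fun z => z.2.2.2 * M.meanRequest z.1 z.2 - z.1.2.2 * z.2.1) ⊤ ρ := by
  have hp : MemLp (fun z => z.2.2.2) ⊤ ρ :=
    memLp_top_of_ae_mem_Icc (by fun_prop) (hρ.mono fun _ hz => hz.2.2.2)
  have hγ : MemLp (fun z => z.1.2.2) ⊤ ρ :=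
    memLp_top_of_ae_mem_Icc (by fun_prop) (hρ.mono fun _ hz => hz.1.2)
  exact ((memLp_meanRequest hρ).mul' hp).sub ((memLp_purchase hρ).mul' hγ)

lemma IsStateOnlyPolicy.ae_admissible {π : Measure (ℝ × Y × ℝ)} [SFinite π]
    {κ : Kernel (ℝ × Y × ℝ) (ℝ × ℝ × ℝ)} (hκ : M.IsStateOnlyPolicy π κ)
    (hπ : ∀ᵐ w ∂π, w.1 ∈ Icc 0 M.sMax ∧ w.2.2 ∈ Icc 0 M.γMax) :
    ∀ᵐ z ∂(π ⊗ₘ κ), M.Admissible z := by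
  refine Measure.ae_compProd_of_ae_ae M.measurableSet_admissible ?_
  filter_upwards [hπ, hκ.constraints] with w hw hd
  filter_upwards [hd] with d hd using ⟨hw, hd⟩

end EnergyMarket

namespace EnergySystem

variable {Ω Y : Type u} {S : EnergySystem Ω Y} [MeasurableSpace Y]

lemma past_mono (S : EnergySystem Ω Y) (t : ℕ) : S.past t ≤ S.past (t + 1) :=
  iSup_le fun τ => le_iSup (fun τ : Fin (t + 1) => MeasurableSpace.comap
    (fun ω => (S.state τ ω, S.decision τ ω, S.a τ ω)) inferInstance) τ.castSucc

lemma measurable_past_succ (S : EnergySystem Ω Y) (t : ℕ) :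
    Measurable[S.past (t + 1)] fun ω => (S.state t ω, S.decision t ω, S.a t ω) :=
  Measurable.of_comap_le (le_iSup (fun τ : Fin (t + 1) => MeasurableSpace.comap
    (fun ω => (S.state τ ω, S.decision τ ω, S.a τ ω)) inferInstance) (Fin.last t))

lemma measurable_past_Q (S : EnergySystem Ω Y) (t : ℕ) : Measurable[S.past t] (S.Q t) := by
  induction t with
  | zero => exact @measurable_const _ _ _ (S.past 0) 0
  | succ t ih =>
    let _ := S.past (t + 1)
    have hQ : Measurable (S.Q t) := ih.mono (S.past_mono t) le_rfl
    have h := S.measurable_past_succ t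
    have hs : Measurable (S.s t) := h.fst.fst
    have hx : Measurable (S.x t) := h.snd.fst.fst
    have ha : Measurable (S.a t) := h.snd.snd
    exact (((hQ.sub hs).sub hx).max measurable_const).add ha

lemma measurable_past_Z (S : EnergySystem Ω Y) (ε : ℝ) (t : ℕ) :
    Measurable[S.past t] (S.Z ε t) := by
  induction t with
  | zero => exact @measurable_const _ _ _ (S.past 0) 0
  | succ t ih =>
    let _ := S.past (t + 1)
    have hZ : Measurable (S.Z ε t) := ih.mono (S.past_mono t) le_rfl
    have hQ : Measurable (S.Q t) := (S.measurable_past_Q t).mono (S.past_mono t) le_rfl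
    have h := S.measurable_past_succ t
    have hs : Measurable (S.s t) := h.fst.fst
    have hx : Measurable (S.x t) := h.snd.fst.fst
    have hi : Measurable fun ω => if 0 < S.Q t ω then (1 : ℝ) else 0 :=
      Measurable.ite (measurableSet_lt measurable_const hQ) measurable_const measurable_const
    exact ((((hZ.sub hs).sub hx).add (hi.const_mul ε))).max measurable_const

lemma measurable_present_decision (S : EnergySystem Ω Y) (t : ℕ) :
    Measurable[S.present t] (S.decision t) := by
  let _ := S.present t
  have h : Measurable fun ω => (S.state t ω, S.decision t ω) :=
    Measurable.of_comap_le le_sup_right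
  exact h.snd

variable [MeasurableSpace Ω] {M : EnergyMarket Y} {μ : Measure Ω} {π : Measure (ℝ × Y × ℝ)}

namespace IsFeasible

lemma measurable_state (hS : S.IsFeasible M) (t : ℕ) : Measurable (S.state t) :=
  (hS.measurable_s t).prodMk ((hS.measurable_y t).prodMk (hS.measurable_γ t))

lemma measurable_slot (hS : S.IsFeasible M) (t : ℕ) :
    Measurable fun ω => (S.state t ω, S.decision t ω) :=
  (hS.measurable_state t).prodMk
    ((hS.measurable_x t).prodMk ((hS.measurable_b t).prodMk (hS.measurable_p t)))

lemma past_le (hS : S.IsFeasible M) (t : ℕ) : S.past t ≤ ‹MeasurableSpace Ω› :=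
  iSup_le fun τ => ((hS.measurable_state τ).prodMk
    ((hS.measurable_slot τ).snd.prodMk (hS.measurable_a τ))).comap_le

lemma present_le (hS : S.IsFeasible M) (t : ℕ) : S.present t ≤ ‹MeasurableSpace Ω› :=
  sup_le (hS.past_le t) (hS.measurable_slot t).comap_le

lemma measurable_Q (hS : S.IsFeasible M) (t : ℕ) : Measurable (S.Q t) :=
  (S.measurable_past_Q t).mono (hS.past_le t) le_rfl

lemma measurable_Z (hS : S.IsFeasible M) (ε : ℝ) (t : ℕ) : Measurable (S.Z ε t) :=
  (S.measurable_past_Z ε t).mono (hS.past_le t) le_rfl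

lemma memLp_s (hS : S.IsFeasible M) (t : ℕ) : MemLp (S.s t) ⊤ μ :=
  memLp_top_of_ae_mem_Icc (hS.measurable_s t) (ae_of_all _ (hS.s_mem t))

lemma memLp_γ (hS : S.IsFeasible M) (t : ℕ) : MemLp (S.γ t) ⊤ μ :=
  memLp_top_of_ae_mem_Icc (hS.measurable_γ t) (ae_of_all _ (hS.γ_mem t))

lemma memLp_x (hS : S.IsFeasible M) (t : ℕ) : MemLp (S.x t) ⊤ μ :=
  memLp_top_of_ae_mem_Icc (hS.measurable_x t) (ae_of_all _ (hS.x_mem t))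

lemma memLp_a (hS : S.IsFeasible M) (t : ℕ) : MemLp (S.a t) ⊤ μ :=
  memLp_top_of_ae_mem_Icc (hS.measurable_a t) (ae_of_all _ (hS.a_mem t))

lemma memLp_p (hS : S.IsFeasible M) (t : ℕ) : MemLp (S.p t) ⊤ μ :=
  memLp_top_of_ae_mem_Icc (hS.measurable_p t) (ae_of_all _ (hS.p_mem t))

lemma memLp_b (hS : S.IsFeasible M) (t : ℕ) : MemLp (S.b t) ⊤ μ :=
  memLp_top_of_ae_mem_Icc (c := 1) (hS.measurable_b t) <| ae_of_all _ fun ω => by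
    rcases hS.b_mem t ω with h | h
    · rw [h]; simp
    · rw [mem_singleton_iff] at h; rw [h]; simp

lemma memLp_Q (hS : S.IsFeasible M) (t : ℕ) : MemLp (S.Q t) ⊤ μ :=
  memLp_top_of_ae_mem_Icc (hS.measurable_Q t) (ae_of_all _ fun ω => ⟨hS.Q_nonneg t ω, hS.Q_le t ω⟩)

lemma memLp_profit (hS : S.IsFeasible M) (t : ℕ) : MemLp (S.profit t) ⊤ μ :=
  ((hS.memLp_a t).mul' ((hS.memLp_p t).mul' (hS.memLp_b t) (r := ⊤))).sub
    ((hS.memLp_x t).mul' (hS.memLp_γ t))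

lemma ae_map_admissible (hS : S.IsFeasible M) (μ : Measure Ω) (t : ℕ) :
    ∀ᵐ z ∂μ.map fun ω => (S.state t ω, S.decision t ω), M.Admissible z :=
  (ae_map_iff (hS.measurable_slot t).aemeasurable M.measurableSet_admissible).2
    (ae_of_all _ (hS.admissible t))

lemma memLp_slot (hS : S.IsFeasible M) (t : ℕ) {f : (ℝ × Y × ℝ) × (ℝ × ℝ × ℝ) → ℝ}
    (hf : MemLp f ⊤ (μ.map fun ω => (S.state t ω, S.decision t ω))) :
    MemLp (fun ω => f (S.state t ω, S.decision t ω)) ⊤ μ :=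
  (memLp_map_measure_iff hf.1 (hS.measurable_slot t).aemeasurable).1 hf

lemma memLp_slot_request (hS : S.IsFeasible M) (t : ℕ) :
    MemLp (fun ω => M.meanRequest (S.state t ω) (S.decision t ω)) ⊤ μ :=
  hS.memLp_slot t (EnergyMarket.memLp_meanRequest (hS.ae_map_admissible μ t))

/-- Requests may be replaced by their mean in products with anything settled before they
arrive. -/
lemma integral_mul_request [IsProbabilityMeasure μ] (hS : S.IsFeasible M)
    (hdem : S.HasDemand M μ) (t : ℕ) {g : Ω → ℝ} (hg : Measurable[S.present t] g)
    (hgb : MemLp g ⊤ μ) :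
    ∫ ω, g ω * S.a t ω ∂μ = ∫ ω, g ω * M.meanRequest (S.state t ω) (S.decision t ω) ∂μ := by
  have hm := hS.present_le t
  have ha : Integrable (S.a t) μ := (hS.memLp_a t).integrable le_top
  have hga : Integrable (g * S.a t) μ := ((hS.memLp_a t).mul hgb).integrable le_top
  calc ∫ ω, g ω * S.a t ω ∂μ = ∫ ω, (μ[g * S.a t | S.present t]) ω ∂μ := (integral_condExp hm).symm
    _ = _ := integral_congr_ae <| by
      filter_upwards [condExp_mul_of_stronglyMeasurable_left hg.stronglyMeasurable hga ha,
        hdem t] with ω h1 h2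
      rw [h1, Pi.mul_apply, h2]
      rfl

lemma integral_request [IsProbabilityMeasure μ] (hS : S.IsFeasible M)
    (hdem : S.HasDemand M μ) (t : ℕ) :
    ∫ ω, S.a t ω ∂μ = ∫ ω, M.meanRequest (S.state t ω) (S.decision t ω) ∂μ := by
  simpa using hS.integral_mul_request hdem t (g := fun _ => 1) measurable_const (memLp_const 1)

lemma b_mul_meanRequest (hS : S.IsFeasible M) (t : ℕ) (ω : Ω) :
    S.b t ω * M.meanRequest (S.state t ω) (S.decision t ω)
      = M.meanRequest (S.state t ω) (S.decision t ω) := by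
  simp only [EnergyMarket.meanRequest, decision]
  rcases hS.b_mem t ω with h | h
  · rw [h]; ring
  · rw [mem_singleton_iff] at h; rw [h]; ring

lemma integral_revenue [IsProbabilityMeasure μ] (hS : S.IsFeasible M)
    (hdem : S.HasDemand M μ) (t : ℕ) :
    ∫ ω, S.b t ω * S.p t ω * S.a t ω ∂μ
      = ∫ ω, S.p t ω * M.meanRequest (S.state t ω) (S.decision t ω) ∂μ := by
  have hd := S.measurable_present_decision t
  have hbp : Measurable[S.present t] fun ω => S.b t ω * S.p t ω :=
    Measurable.mul (m := S.present t) (f := S.b t) (g := S.p t)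
      (measurable_fst.comp (measurable_snd.comp hd)) (measurable_snd.comp (measurable_snd.comp hd))
  rw [hS.integral_mul_request hdem t hbp ((hS.memLp_p t).mul' (hS.memLp_b t))]
  congr 1 with ω
  rw [mul_right_comm, hS.b_mul_meanRequest, mul_comm]

lemma integral_profit [IsProbabilityMeasure μ] (hS : S.IsFeasible M)
    (hdem : S.HasDemand M μ) (t : ℕ) :
    ∫ ω, S.profit t ω ∂μ = ∫ ω, (S.p t ω * M.meanRequest (S.state t ω) (S.decision t ω)
      - S.γ t ω * S.x t ω) ∂μ := by
  have hγx := ((hS.memLp_x t).mul' (hS.memLp_γ t) (r := ⊤) (μ := μ)).integrable le_top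
  have hbpa := ((hS.memLp_a t).mul' ((hS.memLp_p t).mul' (hS.memLp_b t) (r := ⊤)) (r := ⊤)
    (μ := μ)).integrable le_top
  have hpm := ((hS.memLp_slot_request t).mul' (hS.memLp_p t) (r := ⊤) (μ := μ)).integrable le_top
  simp only [profit]
  rw [integral_sub hbpa hγx, integral_sub hpm hγx, hS.integral_revenue hdem]

end IsFeasible

lemma HasIIDStates.isProbabilityMeasure [IsProbabilityMeasure μ] (hiid : S.HasIIDStates μ π)
    (hS : S.IsFeasible M) : IsProbabilityMeasure π :=
  hiid.law 0 ▸ Measure.isProbabilityMeasure_map (hS.measurable_state 0).aemeasurable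

lemma HasIIDStates.ae_state_mem (hiid : S.HasIIDStates μ π) (hS : S.IsFeasible M) :
    ∀ᵐ w ∂π, w.1 ∈ Icc 0 M.sMax ∧ w.2.2 ∈ Icc 0 M.γMax := by
  rw [← hiid.law 0]
  refine (ae_map_iff (hS.measurable_state 0).aemeasurable (.inter ?_ ?_)).2
    (ae_of_all _ fun ω => ⟨hS.s_mem 0 ω, hS.γ_mem 0 ω⟩)
  · exact measurableSet_Icc.preimage (measurable_fst (α := ℝ) (β := Y × ℝ))
  · exact measurableSet_Icc.preimage (by fun_prop : Measurable fun w : ℝ × Y × ℝ => w.2.2)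

/-- The present state is independent of the past, so expectations of products factor. -/
lemma HasIIDStates.integral_mul_state (hiid : S.HasIIDStates μ π) (hS : S.IsFeasible M) (t : ℕ)
    {X : Ω → ℝ} {h : ℝ × Y × ℝ → ℝ} (hX : Measurable[S.past t] X) (hh : Measurable h) :
    ∫ ω, X ω * h (S.state t ω) ∂μ = (∫ ω, X ω ∂μ) * ∫ w, h w ∂π := by
  have hst := hS.measurable_state t
  have hind : IndepFun X (fun ω => h (S.state t ω)) μ :=
    (IndepFun_iff_Indep _ _ _).2 <| indep_of_indep_of_le_left
      (indep_of_indep_of_le_right (hiid.indep t)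
        (hh.comp (comap_measurable (S.state t))).comap_le) hX.comap_le
  rw [hind.integral_fun_mul_eq_mul_integral
    (hX.mono (hS.past_le t) le_rfl).aestronglyMeasurable (hh.comp hst).aestronglyMeasurable,
    ← hiid.law t, integral_map hst.aemeasurable hh.aestronglyMeasurable]

end EnergySystem

/-! ### Comparison with state-only policies -/

namespace EnergyMarket

variable {Y : Type u} [MeasurableSpace Y]

/-- The expected energy `s + x` offered to the queue per slot under a state-only policy. -/
noncomputable def expectedService (π : Measure (ℝ × Y × ℝ))
    (κ : Kernel (ℝ × Y × ℝ) (ℝ × ℝ × ℝ)) : ℝ :=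
  ∫ z, (z.1.1 + z.2.1) ∂(π ⊗ₘ κ)

lemma expectedExcess_eq {M : EnergyMarket Y} {π : Measure (ℝ × Y × ℝ)} [IsProbabilityMeasure π]
    {κ : Kernel (ℝ × Y × ℝ) (ℝ × ℝ × ℝ)} [IsMarkovKernel κ]
    (hadm : ∀ᵐ z ∂(π ⊗ₘ κ), M.Admissible z) :
    M.expectedExcess π κ = M.expectedRequest π κ - expectedService π κ := by
  rw [expectedExcess, expectedRequest, expectedService,
    ← integral_sub ((memLp_meanRequest hadm).integrable le_top)
      ((memLp_service hadm).integrable le_top)]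
  simp only [sub_sub]

end EnergyMarket

namespace EnergySystem

variable {Ω Y : Type u} {S : EnergySystem Ω Y} [MeasurableSpace Ω] [MeasurableSpace Y]
  {M : EnergyMarket Y} {V ε : ℝ} {μ : Measure Ω} {π : Measure (ℝ × Y × ℝ)}
  {κ : Kernel (ℝ × Y × ℝ) (ℝ × ℝ × ℝ)}

lemma HasIIDStates.integrable_mul_kernel [IsProbabilityMeasure π] [IsMarkovKernel κ]
    (hiid : S.HasIIDStates μ π) (hS : S.IsFeasible M) (t : ℕ) {X : Ω → ℝ}
    {f : (ℝ × Y × ℝ) × (ℝ × ℝ × ℝ) → ℝ} (hX : MemLp X ⊤ μ) (hf : Integrable f (π ⊗ₘ κ)) :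
    Integrable (fun ω => X ω * ∫ d, f (S.state t ω, d) ∂κ (S.state t ω)) μ := by
  have h : Integrable (fun w => ∫ d, f (w, d) ∂κ w) π := hf.integral_compProd
  rw [← hiid.law t] at h
  exact (h.comp_measurable (hS.measurable_state t)).mul_of_top_right hX

/-- Independence of the present state from the past, applied to the average of `f` over the
decisions that `κ` draws at the present state. -/
lemma HasIIDStates.integral_mul_kernel [IsProbabilityMeasure π] [IsMarkovKernel κ]
    (hiid : S.HasIIDStates μ π) (hS : S.IsFeasible M) (t : ℕ) {X : Ω → ℝ}
    {f : (ℝ × Y × ℝ) × (ℝ × ℝ × ℝ) → ℝ} (hX : Measurable[S.past t] X) (hfm : Measurable f)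
    (hf : Integrable f (π ⊗ₘ κ)) :
    ∫ ω, X ω * ∫ d, f (S.state t ω, d) ∂κ (S.state t ω) ∂μ
      = (∫ ω, X ω ∂μ) * ∫ z, f z ∂(π ⊗ₘ κ) := by
  rw [hiid.integral_mul_state hS t hX hfm.stronglyMeasurable.integral_kernel_prod_right'.measurable,
    Measure.integral_compProd hf]

namespace IsFeasible

lemma memLp_Z [IsProbabilityMeasure μ] (hS : S.IsFeasible M) (hpol : S.FollowsJointPolicy M V ε)
    (hV : 0 < V) (hε : 0 ≤ ε) (hx : ε ≤ M.xMax) (t : ℕ) : MemLp (S.Z ε t) ⊤ μ :=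
  memLp_top_of_ae_mem_Icc (hS.measurable_Z ε t)
    (ae_of_all _ fun ω => ⟨S.Z_nonneg ε t ω, hS.Z_le_of_joint hpol hV hε hx t ω⟩)

lemma memLp_penalizedDrift [IsProbabilityMeasure μ] (hS : S.IsFeasible M) {t : ℕ}
    (hZ : MemLp (S.Z ε t) ⊤ μ) (V : ℝ) :
    MemLp (fun ω => M.penalizedDrift V ε (S.Q t ω) (S.Z ε t ω) (S.state t ω) (S.decision t ω))
      ⊤ μ := by
  have hadm := hS.ae_map_admissible μ t
  have h1 := hS.memLp_slot t (EnergyMarket.memLp_excess hadm)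
  have h2 := (memLp_const ε).sub (hS.memLp_slot t (EnergyMarket.memLp_service hadm))
  have h3 := (hS.memLp_slot t (EnergyMarket.memLp_meanProfit hadm)).const_mul V
  exact ((h1.mul' (hS.memLp_Q t)).add (h2.mul' hZ)).sub h3

lemma integral_penalizedDrift_le [IsProbabilityMeasure μ] (hS : S.IsFeasible M)
    (hpol : S.FollowsJointPolicy M V ε) (hiid : S.HasIIDStates μ π)
    (hκ : M.IsStateOnlyPolicy π κ) {t : ℕ} (hZ : MemLp (S.Z ε t) ⊤ μ) :
    ∫ ω, M.penalizedDrift V ε (S.Q t ω) (S.Z ε t ω) (S.state t ω) (S.decision t ω) ∂μ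
      ≤ (∫ ω, S.Q t ω ∂μ) * M.expectedExcess π κ
        + (∫ ω, S.Z ε t ω ∂μ) * (ε - EnergyMarket.expectedService π κ)
        - V * M.expectedProfit π κ := by
  have := hiid.isProbabilityMeasure hS
  have := hκ.markov
  have hadm := hκ.ae_admissible (hiid.ae_state_mem hS)
  have hexc := (EnergyMarket.memLp_excess hadm).integrable le_top
  have hsrv : Integrable (fun z => ε - (z.1.1 + z.2.1)) (π ⊗ₘ κ) :=
    ((memLp_const ε).sub (EnergyMarket.memLp_service hadm)).integrable le_top
  have hpro := (EnergyMarket.memLp_meanProfit hadm).integrable le_top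
  have hV : MemLp (fun _ : Ω => V) ⊤ μ := memLp_const V
  have hQX := hiid.integrable_mul_kernel hS t (hS.memLp_Q t) hexc
  have hZX := hiid.integrable_mul_kernel hS t hZ hsrv
  have hVX := hiid.integrable_mul_kernel hS t hV hpro
  have hae : ∀ᵐ w ∂π, (∀ᵐ d ∂κ w, M.Admissible (w, d)) ∧
      Integrable (fun d => M.meanRequest w d - w.1 - d.1) (κ w) ∧
      Integrable (fun d : ℝ × ℝ × ℝ => ε - (w.1 + d.1)) (κ w) ∧
      Integrable (fun d => d.2.2 * M.meanRequest w d - w.2.2 * d.1) (κ w) := by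
    filter_upwards [Measure.ae_ae_of_ae_compProd hadm,
      ((Measure.integrable_compProd_iff hexc.1).1 hexc).1,
      ((Measure.integrable_compProd_iff hsrv.1).1 hsrv).1,
      ((Measure.integrable_compProd_iff hpro.1).1 hpro).1] with w h1 h2 h3 h4
    exact ⟨h1, h2, h3, h4⟩
  rw [← hiid.law t] at hae
  calc ∫ ω, M.penalizedDrift V ε (S.Q t ω) (S.Z ε t ω) (S.state t ω) (S.decision t ω) ∂μ
      ≤ ∫ ω, (S.Q t ω * ∫ d, (M.meanRequest (S.state t ω) d - (S.state t ω).1 - d.1)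
            ∂κ (S.state t ω)
          + S.Z ε t ω * ∫ d, (ε - ((S.state t ω).1 + d.1)) ∂κ (S.state t ω)
          - V * ∫ d, (d.2.2 * M.meanRequest (S.state t ω) d - (S.state t ω).2.2 * d.1)
            ∂κ (S.state t ω)) ∂μ := by
        refine integral_mono_ae ((hS.memLp_penalizedDrift hZ V).integrable le_top)
          ((hQX.add hZX).sub hVX) ?_
        filter_upwards [ae_of_ae_map (hS.measurable_state t).aemeasurable hae] with ω hω
        obtain ⟨h1, h2, h3, h4⟩ := hω
        have hq := h2.const_mul (S.Q t ω)
        have hz := h3.const_mul (S.Z ε t ω)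
        have hv := h4.const_mul V
        have hmono := integral_mono_ae (integrable_const _) ((hq.add hz).sub hv)
          (h1.mono fun d hd => hpol.penalizedDrift_le t ω hd)
        rw [integral_const, probReal_univ, one_smul, integral_sub' (hq.add hz) hv,
          integral_add' hq hz, integral_const_mul, integral_const_mul, integral_const_mul] at hmono
        exact hmono
    _ = _ := by
        have e1 := hiid.integral_mul_kernel (κ := κ) hS t (S.measurable_past_Q t)
          (f := fun z => M.meanRequest z.1 z.2 - z.1.1 - z.2.1)
          (by have := M.measurable_meanRequest; fun_prop) hexc
        have e2 := hiid.integral_mul_kernel (κ := κ) hS t (S.measurable_past_Z ε t)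
          (f := fun z => ε - (z.1.1 + z.2.1)) (by fun_prop) hsrv
        have e3 := hiid.integral_mul_kernel (κ := κ) hS t (X := fun _ => V) measurable_const
          M.measurable_meanProfit hpro
        have e4 : ∫ z, (ε - (z.1.1 + z.2.1)) ∂(π ⊗ₘ κ) = ε - EnergyMarket.expectedService π κ := by
          rw [integral_sub (integrable_const ε)
            ((EnergyMarket.memLp_service hadm).integrable le_top), integral_const, probReal_univ,
            one_smul, EnergyMarket.expectedService]
        rw [e4] at e2
        rw [integral_const, probReal_univ, one_smul] at e3
        refine (integral_sub' (hQX.add hZX) hVX).trans ?_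
        rw [integral_add' hQX hZX, e1, e2, e3]
        rfl

/-- The expected Lyapunov drift of a slot, less `V` times the expected profit. The requests enter
the pathwise bound with the weight `Q - V b p`, which is settled before they arrive. -/
lemma integral_drift_le [IsProbabilityMeasure μ] (hS : S.IsFeasible M) (hdem : S.HasDemand M μ)
    (hε : 0 ≤ ε) {t : ℕ} (hZ : MemLp (S.Z ε t) ⊤ μ) (hZ' : MemLp (S.Z ε (t + 1)) ⊤ μ) (V : ℝ) :
    ∫ ω, S.lyapunov ε (t + 1) ω ∂μ - ∫ ω, S.lyapunov ε t ω ∂μ - V * ∫ ω, S.profit t ω ∂μ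
      ≤ M.driftConst ε + ∫ ω, M.penalizedDrift V ε (S.Q t ω) (S.Z ε t ω) (S.state t ω)
          (S.decision t ω) ∂μ := by
  have hlyap {n : ℕ} (hn : MemLp (S.Z ε n) ⊤ μ) : Integrable (S.lyapunov ε n) μ := by
    have h := ((hS.memLp_Q n).mul' (hS.memLp_Q n) (r := ⊤)).add (hn.mul' hn (r := ⊤))
    refine ((h.integrable le_top).div_const 2).congr (ae_of_all _ fun ω => ?_)
    simp only [lyapunov, Pi.add_apply]; ring
  have hq := hS.memLp_Q (μ := μ) t
  have hQa := ((hS.memLp_a t).mul' hq (r := ⊤)).integrable le_top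
  have hQm := ((hS.memLp_slot_request t).mul' hq (r := ⊤)).integrable le_top
  have hVpr := ((hS.memLp_profit (μ := μ) t).integrable le_top).const_mul V
  have hpen := (hS.memLp_penalizedDrift hZ V).integrable le_top
  have hswap : ∫ ω, S.Q t ω * S.a t ω ∂μ
      = ∫ ω, S.Q t ω * M.meanRequest (S.state t ω) (S.decision t ω) ∂μ :=
    hS.integral_mul_request hdem t ((S.measurable_past_Q t).mono le_sup_left le_rfl) hq
  have hmp : Integrable (fun ω => S.p t ω * M.meanRequest (S.state t ω) (S.decision t ω)
      - S.γ t ω * S.x t ω) μ :=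
    (hS.memLp_slot t (EnergyMarket.memLp_meanProfit (hS.ae_map_admissible μ t))).integrable le_top
  have hVmp := hmp.const_mul V
  have hpath (ω : Ω) : S.lyapunov ε (t + 1) ω - S.lyapunov ε t ω ≤ M.driftConst ε
      + (M.penalizedDrift V ε (S.Q t ω) (S.Z ε t ω) (S.state t ω) (S.decision t ω)
        + V * (S.p t ω * M.meanRequest (S.state t ω) (S.decision t ω) - S.γ t ω * S.x t ω)
        + (S.Q t ω * S.a t ω - S.Q t ω * M.meanRequest (S.state t ω) (S.decision t ω))) := by
    refine (hS.lyapunov_drift_le hε t ω).trans (le_of_eq ?_)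
    simp only [EnergyMarket.penalizedDrift, state, decision]
    ring
  have hint := integral_mono ((hlyap hZ').sub (hlyap hZ))
    ((integrable_const _).add ((hpen.add hVmp).add (hQa.sub hQm))) hpath
  rw [integral_sub' (hlyap hZ') (hlyap hZ),
    integral_add' (integrable_const _) ((hpen.add hVmp).add (hQa.sub hQm)),
    integral_add' (hpen.add hVmp) (hQa.sub hQm), integral_add' hpen hVmp, integral_sub' hQa hQm,
    hswap, integral_const_mul, integral_const, probReal_univ, one_smul,
    ← hS.integral_profit hdem t] at hint
  linarith

/-- The joint policy earns, up to `B / V`, at least the profit of any state-only policy whose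
service is short of the requests and of `ε` by at most `δ`, for a loss proportional to `δ`. -/
lemma expectedProfit_le_avgProfit [IsProbabilityMeasure μ] (hS : S.IsFeasible M)
    (hpol : S.FollowsJointPolicy M V ε) (hV : 0 < V) (hε : 0 ≤ ε) (hx : max M.aMax ε ≤ M.xMax)
    (hiid : S.HasIIDStates μ π) (hdem : S.HasDemand M μ) (hκ : M.IsStateOnlyPolicy π κ) {δ : ℝ}
    (hδ : 0 ≤ δ) (hexc : M.expectedExcess π κ ≤ δ)
    (hsrv : ε - EnergyMarket.expectedService π κ ≤ δ) {t : ℕ} (ht : 0 < t) :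
    M.expectedProfit π κ
      ≤ S.avgProfit μ t + M.driftConst ε / V + (2 * V * M.γMax + M.aMax + ε) / V * δ := by
  have hxa := (le_max_left _ _).trans hx
  have hxε := (le_max_right _ _).trans hx
  have hZ (n : ℕ) : MemLp (S.Z ε n) ⊤ μ := hS.memLp_Z hpol hV hε hxε n
  set R := M.driftConst ε + (2 * V * M.γMax + M.aMax + ε) * δ - V * M.expectedProfit π κ
  have hslot (n : ℕ) : ∫ ω, S.lyapunov ε (n + 1) ω ∂μ - ∫ ω, S.lyapunov ε n ω ∂μ
      - V * ∫ ω, S.profit n ω ∂μ ≤ R := by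
    have hQ0 : 0 ≤ ∫ ω, S.Q n ω ∂μ := integral_nonneg (hS.Q_nonneg n)
    have hZ0 : 0 ≤ ∫ ω, S.Z ε n ω ∂μ := integral_nonneg (S.Z_nonneg ε n)
    have hQ1 : ∫ ω, S.Q n ω ∂μ ≤ V * M.γMax + M.aMax := by
      simpa using integral_mono ((hS.memLp_Q n).integrable le_top) (integrable_const (μ := μ) _)
        (hS.Q_le_of_joint hpol hV hxa n)
    have hZ1 : ∫ ω, S.Z ε n ω ∂μ ≤ V * M.γMax + ε := by
      simpa using integral_mono ((hZ n).integrable le_top) (integrable_const (μ := μ) _)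
        (hS.Z_le_of_joint hpol hV hε hxε n)
    have h1 := hS.integral_drift_le hdem hε (hZ n) (hZ (n + 1)) V
    have h2 := hS.integral_penalizedDrift_le hpol hiid hκ (hZ n)
    have h3 := (mul_le_mul_of_nonneg_left hexc hQ0).trans (mul_le_mul_of_nonneg_right hQ1 hδ)
    have h4 := (mul_le_mul_of_nonneg_left hsrv hZ0).trans (mul_le_mul_of_nonneg_right hZ1 hδ)
    simp only [R]
    linarith
  have hsum : ∫ ω, S.lyapunov ε t ω ∂μ - V * ∑ τ ∈ Finset.range t, ∫ ω, S.profit τ ω ∂μ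
      ≤ t * R := by
    have h := Finset.sum_le_sum fun n (_ : n ∈ Finset.range t) => hslot n
    rw [Finset.sum_sub_distrib, Finset.sum_range_sub (fun n => ∫ ω, S.lyapunov ε n ω ∂μ),
      ← Finset.mul_sum] at h
    simpa [lyapunov, Q, Z] using h
  have hL : 0 ≤ ∫ ω, S.lyapunov ε t ω ∂μ :=
    integral_nonneg fun ω => by simp only [lyapunov, Pi.zero_apply]; positivity
  have ht' : (0 : ℝ) < t := Nat.cast_pos.2 ht
  have havg : S.avgProfit μ t * t = ∑ τ ∈ Finset.range t, ∫ ω, S.profit τ ω ∂μ := by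
    rw [avgProfit]; field_simp
  rw [← havg] at hsum
  have hR : 0 ≤ R + V * S.avgProfit μ t := by
    by_contra! h
    nlinarith
  rw [← mul_le_mul_iff_right₀ hV]
  have e : V * (S.avgProfit μ t + M.driftConst ε / V
      + (2 * V * M.γMax + M.aMax + ε) / V * δ)
      = V * S.avgProfit μ t + M.driftConst ε + (2 * V * M.γMax + M.aMax + ε) * δ := by
    field_simp
  rw [e]
  simp only [R] at hR
  linarith

end IsFeasible

end EnergySystem

/-! ### State-only policies close to a given algorithm -/

/-- Bounded averages leave a nonnegative sequence below every positive slope infinitely often. -/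
lemma frequently_lt_mul_of_average_le {q : ℕ → ℝ} (hq : ∀ n, 0 ≤ q n) {C : ℝ}
    (hC : ∀ᶠ t : ℕ in atTop, (1 / (t : ℝ)) * ∑ τ ∈ Finset.range t, q τ ≤ C) {δ : ℝ} (hδ : 0 < δ) :
    ∃ᶠ n : ℕ in atTop, q n < δ * n := by
  intro hge
  simp only [not_lt] at hge
  obtain ⟨N, hN⟩ := eventually_atTop.1 (hC.and hge)
  obtain ⟨m, hm⟩ := exists_nat_gt (max (N : ℝ) (2 * C / δ))
  have hmN : N < m := by exact_mod_cast (le_max_left _ _).trans_lt hm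
  have hmC : 2 * C < δ * m := by
    have := (le_max_right _ _).trans_lt hm
    rw [div_lt_iff₀ hδ] at this
    linarith
  have hm0 : (0 : ℝ) < m := by exact_mod_cast (Nat.zero_le N).trans_lt hmN
  -- the second half of the first `2 m` terms alone contributes `δ m²`
  have hsum : δ * m * m ≤ ∑ τ ∈ Finset.range (m + m), q τ := by
    rw [Finset.sum_range_add]
    have h1 : 0 ≤ ∑ τ ∈ Finset.range m, q τ := Finset.sum_nonneg fun _ _ => hq _
    have h2 : ∑ _ ∈ Finset.range m, δ * m ≤ ∑ τ ∈ Finset.range m, q (m + τ) := by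
      refine Finset.sum_le_sum fun τ _ => le_trans ?_ (hN (m + τ) (by omega)).2
      gcongr
      omega
    rw [Finset.sum_const, Finset.card_range, nsmul_eq_mul] at h2
    linarith
  have h := (hN (m + m) (by omega)).1
  push_cast at h
  rw [one_div, inv_mul_le_iff₀ (by positivity)] at h
  nlinarith

namespace EnergySystem

variable {Ω Y : Type u} {S : EnergySystem Ω Y} [MeasurableSpace Ω] [MeasurableSpace Y]
  {M : EnergyMarket Y} {μ : Measure Ω} {π : Measure (ℝ × Y × ℝ)}

/-- The average over the slots before `T` of the joint laws of state and decisions. -/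
noncomputable def avgLaw (S : EnergySystem Ω Y) (μ : Measure Ω) (T : ℕ) :
    Measure ((ℝ × Y × ℝ) × (ℝ × ℝ × ℝ)) :=
  (T : ENNReal)⁻¹ • ∑ τ ∈ Finset.range T, μ.map fun ω => (S.state τ ω, S.decision τ ω)

lemma IsFeasible.fst_avgLaw (hS : S.IsFeasible M) (hiid : S.HasIIDStates μ π) {T : ℕ} (hT : 0 < T) :
    (S.avgLaw μ T).fst = π := by
  ext A hA
  have h (τ : ℕ) : μ.map (fun ω => (S.state τ ω, S.decision τ ω)) (Prod.fst ⁻¹' A) = π A := by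
    rw [Measure.map_apply (hS.measurable_slot τ) (measurable_fst hA), ← hiid.law τ,
      Measure.map_apply (hS.measurable_state τ) hA]
    rfl
  rw [Measure.fst_apply hA, avgLaw, Measure.smul_apply, Measure.finsetSum_apply]
  simp only [h, Finset.sum_const, Finset.card_range, nsmul_eq_mul, smul_eq_mul]
  rw [← mul_assoc, ENNReal.inv_mul_cancel (by exact_mod_cast hT.ne') (ENNReal.natCast_ne_top T),
    one_mul]

lemma IsFeasible.ae_avgLaw_admissible (hS : S.IsFeasible M) (T : ℕ) :
    ∀ᵐ z ∂S.avgLaw μ T, M.Admissible z :=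
  Measure.ae_smul_measure
    (ae_finsetSum_measure_iff.2 fun τ _ => hS.ae_map_admissible μ τ) _

lemma IsFeasible.integral_avgLaw [IsProbabilityMeasure μ] (hS : S.IsFeasible M) (T : ℕ)
    {f : (ℝ × Y × ℝ) × (ℝ × ℝ × ℝ) → ℝ} (hf : Measurable f)
    (hfi : ∀ τ, MemLp f ⊤ (μ.map fun ω => (S.state τ ω, S.decision τ ω))) :
    ∫ z, f z ∂S.avgLaw μ T
      = (1 / (T : ℝ)) * ∑ τ ∈ Finset.range T, ∫ ω, f (S.state τ ω, S.decision τ ω) ∂μ := by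
  have (τ : ℕ) := Measure.isProbabilityMeasure_map (μ := μ) (hS.measurable_slot τ).aemeasurable
  rw [avgLaw, integral_smul_measure,
    integral_finsetSum_measure fun τ _ => (hfi τ).integrable le_top]
  simp only [integral_map (hS.measurable_slot _).aemeasurable hf.aestronglyMeasurable,
    ENNReal.toReal_inv, ENNReal.toReal_natCast, smul_eq_mul, one_div]

/-- The decisions of the first `T` slots, averaged given the state, form a state-only policy with
the average profit of the algorithm, and with the average growth of its backlog as a bound on the
excess of requests over service. -/
lemma exists_stateOnly_of_average [IsProbabilityMeasure μ] (hS : S.IsFeasible M)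
    (hiid : S.HasIIDStates μ π) (hdem : S.HasDemand M μ) {T : ℕ} (hT : 0 < T) :
    ∃ κ, M.IsStateOnlyPolicy π κ ∧ M.expectedProfit π κ = S.avgProfit μ T ∧
      M.expectedExcess π κ ≤ (∫ ω, S.Q T ω ∂μ) / T := by
  have hπ := hiid.isProbabilityMeasure hS
  have hfst := hS.fst_avgLaw hiid hT
  have : IsProbabilityMeasure (S.avgLaw μ T) :=
    ⟨by rw [← Measure.fst_univ, hfst]; exact measure_univ⟩
  have hdis : π ⊗ₘ (S.avgLaw μ T).condKernel = S.avgLaw μ T := by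
    conv_lhs => rw [← hfst]
    exact (S.avgLaw μ T).disintegrate _
  have hadm : ∀ᵐ z ∂(π ⊗ₘ (S.avgLaw μ T).condKernel), M.Admissible z :=
    hdis.symm ▸ hS.ae_avgLaw_admissible T
  refine ⟨(S.avgLaw μ T).condKernel, ⟨inferInstance, ?_⟩, ?_, ?_⟩
  · filter_upwards [Measure.ae_ae_of_ae_compProd hadm] with w hw
    exact hw.mono fun d hd => hd.2
  · rw [EnergyMarket.expectedProfit, hdis, hS.integral_avgLaw T M.measurable_meanProfit
      fun τ => EnergyMarket.memLp_meanProfit (hS.ae_map_admissible μ τ), avgProfit]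
    simp only [hS.integral_profit hdem]
    rfl
  · have hmeas : Measurable fun z : (ℝ × Y × ℝ) × (ℝ × ℝ × ℝ) =>
        M.meanRequest z.1 z.2 - z.1.1 - z.2.1 := by
      have := M.measurable_meanRequest
      fun_prop
    rw [EnergyMarket.expectedExcess, hdis, hS.integral_avgLaw T hmeas
      fun τ => EnergyMarket.memLp_excess (hS.ae_map_admissible μ τ), one_div, inv_mul_eq_div]
    refine div_le_div_of_nonneg_right ?_ (Nat.cast_nonneg T)
    have hslot (τ : ℕ) : ∫ ω, (M.meanRequest (S.state τ ω) (S.decision τ ω) - S.s τ ω - S.x τ ω) ∂μ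
        ≤ ∫ ω, S.Q (τ + 1) ω ∂μ - ∫ ω, S.Q τ ω ∂μ := by
      have hs := (hS.memLp_s (μ := μ) τ).integrable le_top
      have hx := (hS.memLp_x (μ := μ) τ).integrable le_top
      have ha := (hS.memLp_a (μ := μ) τ).integrable le_top
      have hm := (hS.memLp_slot_request (μ := μ) τ).integrable le_top
      have hQ := (hS.memLp_Q (μ := μ) τ).integrable le_top
      have hQ' := (hS.memLp_Q (μ := μ) (τ + 1)).integrable le_top
      have h := integral_mono (hQ.add ((ha.sub hs).sub hx)) hQ' (S.Q_add_sub_le_Q_succ τ)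
      rw [integral_add' hQ ((ha.sub hs).sub hx), integral_sub' (ha.sub hs) hx, integral_sub' ha hs,
        hS.integral_request hdem] at h
      refine ((integral_sub' (hm.sub hs) hx).trans_le ?_)
      rw [integral_sub' hm hs]
      linarith
    refine (Finset.sum_le_sum fun τ _ => hslot τ).trans ?_
    rw [Finset.sum_range_sub (fun n => ∫ ω, S.Q n ω ∂μ)]
    simp [Q]

/-- Every achievable profit is nearly achieved by a state-only policy that nearly balances requests
and service: with a finite average backlog, `E[Q(T)] / T` is small for arbitrarily large `T`. -/
lemma exists_stateOnly_of_mem_achievableProfit {v δ : ℝ} (hv : v ∈ M.achievableProfit π)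
    (hδ : 0 < δ) :
    ∃ κ, M.IsStateOnlyPolicy π κ ∧ v - δ ≤ M.expectedProfit π κ ∧ M.expectedExcess π κ ≤ δ := by
  obtain ⟨Ω', _, μ', S', hμ, hS, hiid, hdem, hback, hlim⟩ := hv
  obtain ⟨C, hC1, hC2⟩ := EReal.lt_iff_exists_real_btwn.1 hback
  have hC := (eventually_lt_of_limsup_lt hC1).mono fun t ht => (EReal.coe_lt_coe_iff.1 ht).le
  have hfreq := frequently_lt_mul_of_average_le
    (fun n => integral_nonneg (μ := μ') (hS.Q_nonneg n)) hC hδ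
  have hev := (hlim.eventually_const_lt (sub_lt_self v hδ)).and (eventually_gt_atTop 0)
  obtain ⟨T, hTQ, hTv, hT⟩ := (hfreq.and_eventually hev).exists
  obtain ⟨κ, hκ, hprofit, hexc⟩ := exists_stateOnly_of_average hS hiid hdem hT
  refine ⟨κ, hκ, hprofit ▸ hTv.le, hexc.trans ?_⟩
  rw [div_le_iff₀ (by exact_mod_cast hT)]
  exact hTQ.le

/-! ### The performance bound -/

lemma HasIIDStates.integral_s_le_expectedService [IsProbabilityMeasure μ] (hS : S.IsFeasible M)
    (hiid : S.HasIIDStates μ π) {κ : Kernel (ℝ × Y × ℝ) (ℝ × ℝ × ℝ)}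
    (hκ : M.IsStateOnlyPolicy π κ) :
    ∫ ω, S.s 0 ω ∂μ ≤ EnergyMarket.expectedService π κ := by
  have := hiid.isProbabilityMeasure hS
  have := hκ.markov
  have hadm := hκ.ae_admissible (hiid.ae_state_mem hS)
  have hs : ∫ z, z.1.1 ∂(π ⊗ₘ κ) = ∫ ω, S.s 0 ω ∂μ := by
    rw [Measure.integral_compProd ((EnergyMarket.memLp_supply hadm).integrable le_top)]
    simp only [integral_const, probReal_univ, one_smul]
    rw [← hiid.law 0, integral_map (hS.measurable_state 0).aemeasurable
      measurable_fst.aestronglyMeasurable]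
    rfl
  rw [← hs]
  exact integral_mono_ae ((EnergyMarket.memLp_supply hadm).integrable le_top)
    ((EnergyMarket.memLp_service hadm).integrable le_top)
    (hadm.mono fun z hz => le_add_of_nonneg_right hz.2.1.1)

/-- Accepting no requests and purchasing nothing has no profit in any slot. So `φ*` is never the
supremum of an empty set. -/
lemma zero_mem_achievableProfit [IsProbabilityMeasure μ] (hS : S.IsFeasible M)
    (hiid : S.HasIIDStates μ π) : 0 ∈ M.achievableProfit π := by
  obtain ⟨ω₀⟩ := μ.nonempty_of_neZero
  let S₀ : EnergySystem Ω Y :=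
    ⟨S.s, S.y, S.γ, fun _ _ => 0, fun _ _ => 0, fun _ _ => 0, fun _ _ => 0⟩
  have h0 {l c : ℝ} {f : Ω → ℝ} (h : ∀ ω, f ω ∈ Icc l c) : l ≤ c := (h ω₀).1.trans (h ω₀).2
  have hprofit (t : ℕ) (ω : Ω) : S₀.profit t ω = 0 := by simp [profit, S₀]
  have hQ (t : ℕ) (ω : Ω) : S₀.Q t ω = 0 := by
    induction t with
    | zero => rfl
    | succ t ih => rw [Q, ih]; simp [S₀, (hS.s_mem t ω).1]
  refine ⟨Ω, _, μ, S₀, ‹_›, ?_, ⟨hiid.law, fun t => ?_⟩, fun t => ?_, ?_, ?_⟩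
  · exact {
      measurable_s := hS.measurable_s
      measurable_y := hS.measurable_y
      measurable_γ := hS.measurable_γ
      measurable_x := fun _ => measurable_const
      measurable_b := fun _ => measurable_const
      measurable_p := fun _ => measurable_const
      measurable_a := fun _ => measurable_const
      s_mem := hS.s_mem
      γ_mem := hS.γ_mem
      a_mem := fun t ω => ⟨le_rfl, h0 (hS.a_mem t)⟩
      x_mem := fun t ω => ⟨le_rfl, h0 (hS.x_mem t)⟩
      b_mem := fun _ _ => Or.inl rfl
      p_mem := fun t ω => ⟨le_rfl, h0 (hS.p_mem t)⟩
      a_eq_zero := fun _ _ _ => rfl }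
  · refine indep_of_indep_of_le_left (hiid.indep t) (iSup_mono fun τ => ?_)
    have hm : Measurable fun z : (ℝ × Y × ℝ) × (ℝ × ℝ × ℝ) × ℝ =>
        (z.1, ((0, 0, 0) : ℝ × ℝ × ℝ), (0 : ℝ)) := by fun_prop
    exact (hm.comp (comap_measurable fun ω => (S.state τ ω, S.decision τ ω, S.a τ ω))).comap_le
  · have ha : S₀.a t = 0 := rfl
    have hb : (fun ω => S₀.b t ω * M.F (S₀.p t ω) (S₀.y t ω) (S₀.γ t ω)) = 0 :=
      funext fun _ => zero_mul _
    rw [ha, hb, condExp_zero]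
  · simp [avgBacklog, hQ]
  · have havg : S₀.avgProfit μ = fun _ => 0 := by ext t; simp [avgProfit, hprofit]
    rw [havg]
    exact tendsto_const_nhds

end EnergySystem

theorem theorem2 {Ω Y : Type u} [MeasurableSpace Ω] [MeasurableSpace Y]
    (μ : Measure Ω) [IsProbabilityMeasure μ]
    (M : EnergyMarket Y) (S : EnergySystem Ω Y) (V ε : ℝ)
    (hV : 0 < V) (hε : 0 ≤ ε) (hx : max M.aMax ε ≤ M.xMax)
    (hS : S.IsFeasible M) (hpol : S.FollowsJointPolicy M V ε) :
    -- (a) worst-case backlogs and worst-case delay, on every sample path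
    ((∀ t ω, S.Q t ω ≤ V * M.γMax + M.aMax) ∧
      (∀ t ω, S.Z ε t ω ≤ V * M.γMax + ε) ∧
      (0 < ε → ∀ ω, S.FifoDelayLE ⌈(2 * V * M.γMax + M.aMax + ε) / ε⌉₊ ω)) ∧
    -- (b) expected time-average profit, for i.i.d. states
    (∀ π : Measure (ℝ × Y × ℝ), S.HasIIDStates μ π → S.HasDemand M μ →
      ε ≤ max (M.aStar π) (∫ ω, S.s 0 ω ∂μ) →
      ∀ t : ℕ, 0 < t → M.phiStar π - M.driftConst ε / V ≤ S.avgProfit μ t) := by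
  have hQ := hS.Q_le_of_joint hpol hV ((le_max_left _ _).trans hx)
  have hZ := hS.Z_le_of_joint hpol hV hε ((le_max_right _ _).trans hx)
  refine ⟨⟨hQ, hZ, fun hε' ω => ?_⟩, fun π hiid hdem hεle t ht => ?_⟩
  · have h := hS.fifoDelayLE hε' (fun t => hQ t ω) (fun t => hZ t ω)
    rwa [show V * M.γMax + M.aMax + (V * M.γMax + ε) = 2 * V * M.γMax + M.aMax + ε by ring] at h
  obtain ⟨ω₀⟩ := μ.nonempty_of_neZero
  have := hiid.isProbabilityMeasure hS
  set C := (2 * V * M.γMax + M.aMax + ε) / V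
  have hC : 0 ≤ C := by
    have hγ := (hS.γ_mem 0 ω₀).1.trans (hS.γ_mem 0 ω₀).2
    have ha := (hS.a_mem 0 ω₀).1.trans (hS.a_mem 0 ω₀).2
    positivity
  have hs0 : 0 ≤ ∫ ω, S.s 0 ω ∂μ := integral_nonneg fun ω => (hS.s_mem 0 ω).1
  rw [sub_le_iff_le_add]
  rcases le_or_gt ε (∫ ω, S.s 0 ω ∂μ) with hεs | hεs
  · refine csSup_le ⟨0, EnergySystem.zero_mem_achievableProfit hS hiid⟩ fun v hv => ?_
    refine le_of_forall_pos_le_add fun η hη => ?_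
    have hδ : 0 < η / (1 + C) := by positivity
    obtain ⟨κ, hκ, hprofit, hexc⟩ :=
      EnergySystem.exists_stateOnly_of_mem_achievableProfit hv hδ
    have h := hS.expectedProfit_le_avgProfit hpol hV hε hx hiid hdem hκ hδ.le hexc
      (by linarith [hiid.integral_s_le_expectedService hS hκ]) ht
    have e : η / (1 + C) + C * (η / (1 + C)) = η := by field_simp
    linarith
  · have hεa : ε ≤ M.aStar π := (le_max_iff.1 hεle).resolve_right (not_le.2 hεs)
    -- `a*` is positive here, so it is not the value of `sSup` at the empty set
    have hne := nonempty_iff_ne_empty.2 fun h : {r | ∃ κ : Kernel (ℝ × Y × ℝ) (ℝ × ℝ × ℝ),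
        M.IsStateOnlyPolicy π κ ∧ M.expectedProfit π κ = M.phiStar π ∧
          M.expectedExcess π κ ≤ 0 ∧ M.expectedRequest π κ = r} = ∅ => by
      rw [EnergyMarket.aStar, h, Real.sSup_empty] at hεa
      linarith
    refine le_of_forall_pos_le_add fun η hη => ?_
    have hδ : 0 < η / (1 + C) := by positivity
    obtain ⟨r, ⟨κ, hκ, hprofit, hexc, hr⟩, hlt⟩ :=
      exists_lt_of_lt_csSup hne (sub_lt_self (M.aStar π) hδ)
    have := hκ.markov
    have heq := EnergyMarket.expectedExcess_eq (hκ.ae_admissible (hiid.ae_state_mem hS))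
    have h := hS.expectedProfit_le_avgProfit hpol hV hε hx hiid hdem hκ hδ.le
      (hexc.trans hδ.le) (by linarith) ht
    have e : η / (1 + C) + C * (η / (1 + C)) = η := by field_simp
    linarith
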